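/- All algebras are unital. A \emph{local Banach algebra} is a normed complex algebra $A$, with completion $\hat A$, such that for every natural number $m$ the matrix algebra $M_m(A)$ is closed under the holomorphic functional calculus: whenever $x \in M_m(A)$ and $f$ is holomorphic on an open neighbourhood of the spectrum of $x$ in $M_m(\hat A)$, the element $f(x) \in M_m(\hat A)$ lies in $M_m(A)$. A \emph{local $C^*$-algebra} is a local Banach $*$-algebra $A$ with $\|x^*x\| = \|x\|^2$ for all $x \in A$. For an integer $n \ge 2$, an \emph{$n$-potent} in $A$ is an element $e$ with $e^n = e$, and an \emph{$n$-partition of unity} in $A$ is an $n$-tuple $(e_0, \dots, e_{n-1})$ of idempotents with $e_0 + \cdots + e_{n-1} = 1$ and $e_j e_k = 0$ for $j \neq k$; it is \emph{self-adjoint} if $e_k^* = e_k$ for all $k$, i.e. if each $e_k$ is a projection. Proposition. Let $A$ be a local $C^*$-algebra and let $n \ge 2$ be an integer. (1) Every $n$-partition of unity in $A$ is similar to a self-adjoint one: for every $n$-partition of unity $(e_0, \dots, e_{n-1})$ in $A$ there are an invertible $z \in A$ and a self-adjoint $n$-partition of unity $(p_0, \dots, p_{n-1})$ in $A$ with $z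 e_k z^{-1} = p_k$ for all $0 \le k \le n-1$. (2) Every $n$-potent in $A$ is similar to a normal $n$-potent: for every $e \in A$ with $e^n = e$ there are an invertible $z \in A$ and an element $f \in A$ with $f^n = f$, $f^* f = f f^*$ and $f = z e z^{-1}$. -/

import Mathlib

noncomputable section

/-! ### The holomorphic functional calculus of a Banach algebra -/

/-- The winding number around `w` of the cycle formed by the closed curves
`γ i : [0, 1] → ℂ`, namely the sum of the `(2πi)⁻¹ ∮ dz / (z - w)`. -/
def cycleWindingNumber {N : ℕ} (γ : Fin N → ℝ → ℂ) (w : ℂ) : ℂ :=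
  (2 * Real.pi * Complex.I)⁻¹ *
    ∑ i, ∫ t in (0 : ℝ)..1, deriv (γ i) t / (γ i t - w)

/-- The continuously differentiable closed curves `γ i : [0, 1] → ℂ` form a cycle in `U \ K` that
winds exactly once around each point of `K` and does not wind around any point outside `U`.
(A curve may have zero velocity, so that closed polygons are included after
reparametrisation.) -/
structure IsCauchyCycle (K U : Set ℂ) {N : ℕ} (γ : Fin N → ℝ → ℂ) : Prop where
  contDiff : ∀ i, ContDiff ℝ 1 (γ i)
  closed : ∀ i, γ i 0 = γ i 1
  mem : ∀ i, ∀ t ∈ Set.Icc (0 : ℝ) 1, γ i t ∈ U \ K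
  winding_eq_one : ∀ w ∈ K, cycleWindingNumber γ w = 1
  winding_eq_zero : ∀ w, w ∉ U → cycleWindingNumber γ w = 0

/-- The Cauchy (Riesz–Dunford) integral `(2πi)⁻¹ ∮ f(z) (z - x)⁻¹ dz` along the cycle `γ`. -/
def cauchyIntegralAlong {B : Type*} [NormedRing B] [NormedAlgebra ℂ B]
    (x : B) (f : ℂ → ℂ) {N : ℕ} (γ : Fin N → ℝ → ℂ) : B :=
  (2 * Real.pi * Complex.I)⁻¹ •
    ∑ i, ∫ t in (0 : ℝ)..1, (deriv (γ i) t * f (γ i t)) • resolvent x (γ i t)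

/-- `y = f(x)` in the holomorphic functional calculus of the Banach algebra `B`: the function `f`
is holomorphic on some open neighbourhood `U` of the spectrum of `x`, and `y` is the Cauchy integral
of `f` along a cycle in `U` that surrounds the spectrum. (By Cauchy's theorem the value does not
depend on `U` or on the cycle.) -/
def IsHolomorphicFunctionalCalculus {B : Type*} [NormedRing B] [NormedAlgebra ℂ B]
    (x : B) (f : ℂ → ℂ) (y : B) : Prop :=
  ∃ U : Set ℂ, IsOpen U ∧ spectrum ℂ x ⊆ U ∧ DifferentiableOn ℂ f U ∧
    ∃ (N : ℕ) (γ : Fin N → ℝ → ℂ),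
      IsCauchyCycle (spectrum ℂ x) U γ ∧ y = cauchyIntegralAlong x f γ

/-- A subset `S` of a Banach algebra is closed under the holomorphic functional calculus. -/
def IsClosedUnderHolomorphicFunctionalCalculus {B : Type*} [NormedRing B] [NormedAlgebra ℂ B]
    (S : Set B) : Prop :=
  ∀ x ∈ S, ∀ (f : ℂ → ℂ) (y : B), IsHolomorphicFunctionalCalculus x f y → y ∈ S

/-! ### Local Banach algebras and local C*-algebras -/

/-- The completion of a (possibly noncommutative) normed complex algebra is a Banach algebra. -/
instance completionNormedAlgebra (A : Type*) [NormedRing A] [NormedAlgebra ℂ A] :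
    NormedAlgebra ℂ (UniformSpace.Completion A) where
  norm_smul_le := norm_smul_le

/-- The inclusion of `M_m(A)` into `M_m(Â)`, where `Â` is the completion of `A`. -/
def matrixToCompletion (A : Type*) [NormedRing A] (m : ℕ) (x : Matrix (Fin m) (Fin m) A) :
    Matrix (Fin m) (Fin m) (UniformSpace.Completion A) :=
  x.map (fun a : A => (a : UniformSpace.Completion A))

section

/- Any of the usual (mutually equivalent) Banach algebra norms on the matrix algebras will do. -/
attribute [local instance] Matrix.linftyOpNormedRing Matrix.linftyOpNormedAlgebra

/-- A (unital) normed complex algebra `A` is a local Banach algebra if every matrix algebra `M_m(A)`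
is closed under the holomorphic functional calculus of its completion `M_m(Â)`. -/
def IsLocalBanachAlgebra (A : Type*) [NormedRing A] [NormedAlgebra ℂ A] : Prop :=
  ∀ m : ℕ, IsClosedUnderHolomorphicFunctionalCalculus (Set.range (matrixToCompletion A m))

end

/-- A local C*-algebra is a local Banach `*`-algebra satisfying the C*-identity. -/
structure IsLocalCStarAlgebra (A : Type*) [NormedRing A] [NormedAlgebra ℂ A] [StarRing A]
    [StarModule ℂ A] : Prop where
  isLocalBanachAlgebra : IsLocalBanachAlgebra A
  norm_star_mul_self : ∀ x : A, ‖star x * x‖ = ‖x‖ ^ 2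

/-! ### `n`-potents and `n`-partitions of unity -/

/-- An `n`-potent is an element `e` with `e ^ n = e`. -/
def IsNPotent {R : Type*} [Ring R] (n : ℕ) (e : R) : Prop := e ^ n = e

/-- Similarity of elements: `f = z e z⁻¹` for some invertible `z`. -/
def IsSimilar {R : Type*} [Ring R] (e f : R) : Prop :=
  ∃ z : Rˣ, f = (z : R) * e * (↑z⁻¹ : R)

/-- An `n`-partition of unity: an `n`-tuple of pairwise orthogonal idempotents with sum `1`. -/
abbrev IsPartitionOfUnity {R : Type*} [Ring R] {n : ℕ} (e : Fin n → R) : Prop :=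
  CompleteOrthogonalIdempotents e

/-- The partition `e` is similar to the partition `f`: a single invertible `z` conjugates every
`e k` to `f k`. -/
def IsSimilarPartition {R : Type*} [Ring R] {n : ℕ} (e f : Fin n → R) : Prop :=
  ∃ z : Rˣ, ∀ k, (z : R) * e k * (↑z⁻¹ : R) = f k

/-- A partition of unity is self-adjoint if each of its members is (hence is a projection). -/
def IsSelfAdjointPartition {R : Type*} [Ring R] [StarRing R] {n : ℕ} (e : Fin n → R) : Prop :=
  IsPartitionOfUnity e ∧ ∀ k, IsSelfAdjoint (e k)

end

open Complex MeasureTheory UniformSpace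
open scoped Real

noncomputable section

/-! ### The Cauchy integral of a normal element over a circle -/

/-! The proof is Weyl's unitarian trick. Given a partition of unity, let S = ∑ e_k^* e_k.
Orthogonality gives S e_k = e_k^* e_k = e_k^* S, so each e_k is self-adjoint for the form defined by
S, and conjugation by z = S^{1/2} makes it self-adjoint in the ordinary sense (`star_conj_eq_conj`).
For an n-potent e, the powers e, ..., e^{n-1} form a cyclic group with unit e^{n-1}. Averaging over
it and adding the complementary idempotent, S = ∑_j (e^j)^* e^j + (1 - e^{n-1})^* (1 - e^{n-1}),
gives e^* S = S e', where e' is the inverse of e in that group. So f = z e z⁻¹ has a power of itself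
as adjoint and is normal. The analytic point is that z is invertible in A itself. Some of the
summands' factors add up to 1, so S is bounded below by a positive scalar in the completion
(`star_sum_mul_sum_le`). Its spectrum then lies in a disc inside the slit plane, where the square
root and its reciprocal are holomorphic. On such a disc the Cauchy integral equals the continuous
functional calculus (`isHolomorphicFunctionalCalculus_cfc`), and locality puts both values in A. -/

/-- The circle with centre `c` and radius `R`, parametrised by `[0, 1]`. -/
def unitCircleMap (c : ℂ) (R t : ℝ) : ℂ := circleMap c R (2 * π * t)

lemma hasDerivAt_unitCircleMap (c : ℂ) (R t : ℝ) :
    HasDerivAt (unitCircleMap c R) ((2 * π : ℝ) * deriv (circleMap c R) (2 * π * t)) t := by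
  have h := (differentiable_circleMap c R (2 * π * t)).hasDerivAt.scomp t
    ((hasDerivAt_id t).const_mul (2 * π))
  exact h.congr_deriv (by simp)

lemma deriv_unitCircleMap (c : ℂ) (R t : ℝ) :
    deriv (unitCircleMap c R) t = (2 * π : ℝ) * deriv (circleMap c R) (2 * π * t) :=
  (hasDerivAt_unitCircleMap c R t).deriv

lemma contDiff_unitCircleMap (c : ℂ) (R : ℝ) : ContDiff ℝ 1 (unitCircleMap c R) := by
  have : ContDiff ℝ 1 (circleMap c R) := contDiff_circleMap c R
  exact this.comp (contDiff_const.mul contDiff_id)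

lemma unitCircleMap_mem_sphere (c : ℂ) {R : ℝ} (hR : 0 ≤ R) (t : ℝ) :
    unitCircleMap c R t ∈ Metric.sphere c R :=
  circleMap_mem_sphere c hR _

lemma integral_deriv_unitCircleMap_mul (c : ℂ) (R : ℝ) (g : ℂ → ℂ) :
    ∫ t in (0 : ℝ)..1, deriv (unitCircleMap c R) t * g (unitCircleMap c R t) =
      ∮ z in C(c, R), g z := by
  have h := intervalIntegral.smul_integral_comp_mul_left (a := 0) (b := 1)
    (fun θ => deriv (circleMap c R) θ * g (circleMap c R θ)) (2 * π)
  simp only [mul_zero, mul_one] at h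
  simp only [circleIntegral, smul_eq_mul, ← h, ← intervalIntegral.integral_smul,
    deriv_unitCircleMap, unitCircleMap, Complex.real_smul, mul_assoc]

lemma isCauchyCycle_unitCircleMap {c : ℂ} {R : ℝ} (hR : 0 < R) {K U : Set ℂ}
    (hK : K ⊆ Metric.ball c R) (hU : Metric.closedBall c R ⊆ U) :
    IsCauchyCycle K U (fun _ : Fin 1 => unitCircleMap c R) where
  contDiff _ := contDiff_unitCircleMap c R
  closed _ := by simp [unitCircleMap, circleMap]
  mem _ t _ := by
    have h := unitCircleMap_mem_sphere c hR.le t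
    exact ⟨hU (Metric.sphere_subset_closedBall h),
      fun hk => (Metric.mem_ball.1 (hK hk)).ne (Metric.mem_sphere.1 h)⟩
  winding_eq_one w hw := by
    simp only [cycleWindingNumber, div_eq_mul_inv, Finset.univ_unique, Finset.sum_singleton,
      integral_deriv_unitCircleMap_mul c R (fun z => (z - w)⁻¹)]
    rw [circleIntegral.integral_sub_inv_of_mem_ball (hK hw), inv_mul_cancel₀ two_pi_I_ne_zero]
  winding_eq_zero w hw := by
    have hd : ∀ z ∈ Metric.closedBall c R, z - w ≠ 0 := fun z hz h =>
      hw (hU (sub_eq_zero.1 h ▸ hz))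
    have h0 : ∮ z in C(c, R), (z - w)⁻¹ = 0 := by
      refine DiffContOnCl.circleIntegral_eq_zero hR.le (DifferentiableOn.diffContOnCl ?_)
      rw [closure_ball c hR.ne']
      exact DifferentiableOn.inv (by fun_prop) hd
    simp only [cycleWindingNumber, div_eq_mul_inv, Finset.univ_unique, Finset.sum_singleton,
      integral_deriv_unitCircleMap_mul c R (fun z => (z - w)⁻¹), h0, mul_zero]

lemma smul_resolvent_eq_cfc {B : Type*} [CStarAlgebra B] (x : B) [IsStarNormal x] (a : ℂ) {z : ℂ}
    (hz : z ∉ spectrum ℂ x) : a • resolvent x z = cfc (fun w => a * (z - w)⁻¹) x := by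
  have hne : ∀ w ∈ spectrum ℂ x, z - w ≠ 0 := fun w hw h => hz (sub_eq_zero.1 h ▸ hw)
  have hcont : ContinuousOn (fun w => (z - w)⁻¹) (spectrum ℂ x) :=
    ContinuousOn.inv₀ (by fun_prop) hne
  rw [cfc_const_mul a (fun w => (z - w)⁻¹) x hcont, resolvent,
    cfc_inv (fun w => z - w) x hne, cfc_sub (fun _ => z) (fun w => w) x, cfc_const z x, cfc_id' ℂ x]

/-- For a normal element of a C*-algebra the holomorphic functional calculus agrees with the
continuous one, provided a disc separates the spectrum from the singularities of `f`. -/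
theorem isHolomorphicFunctionalCalculus_cfc {B : Type*} [CStarAlgebra B] (x : B) [IsStarNormal x]
    {c : ℂ} {R : ℝ} (hR : 0 < R) {U : Set ℂ} (hUo : IsOpen U) (hx : spectrum ℂ x ⊆ Metric.ball c R)
    (hU : Metric.closedBall c R ⊆ U) {f : ℂ → ℂ} (hf : DifferentiableOn ℂ f U) :
    IsHolomorphicFunctionalCalculus x f (cfc f x) := by
  refine ⟨U, hUo, (hx.trans Metric.ball_subset_closedBall).trans hU, hf, 1, _,
    isCauchyCycle_unitCircleMap hR hx hU, ?_⟩
  have hmem := fun t => unitCircleMap_mem_sphere c hR.le t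
  have hγ : Continuous (unitCircleMap c R) := (contDiff_unitCircleMap c R).continuous
  have hγ' : Continuous (deriv (unitCircleMap c R)) :=
    (contDiff_unitCircleMap c R).continuous_deriv le_rfl
  have hfγ : Continuous fun t => f (unitCircleMap c R t) :=
    hf.continuousOn.comp_continuous hγ fun t => hU (Metric.sphere_subset_closedBall (hmem t))
  have hnot : ∀ t, unitCircleMap c R t ∉ spectrum ℂ x := fun t h =>
    (Metric.mem_ball.1 (hx h)).ne (Metric.mem_sphere.1 (hmem t))
  have hg : Continuous fun t => deriv (unitCircleMap c R) t * f (unitCircleMap c R t) := hγ'.mul hfγ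
  set F : ℝ → ℂ → ℂ := fun t w =>
    (deriv (unitCircleMap c R) t * f (unitCircleMap c R t)) * (unitCircleMap c R t - w)⁻¹
  have hF : ContinuousOn (Function.uncurry F) (Set.univ ×ˢ spectrum ℂ x) := by
    refine ContinuousOn.mul (hg.comp continuous_fst).continuousOn (ContinuousOn.inv₀ (by fun_prop) ?_)
    rintro ⟨t, w⟩ ⟨-, hw⟩ h
    exact hnot t (sub_eq_zero.1 h ▸ hw)
  obtain ⟨M, hM⟩ := (isCompact_Icc (a := (0 : ℝ)) (b := 1)).prod (spectrum.isCompact (𝕜 := ℂ) x)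
    |>.exists_bound_of_continuousOn (hF.mono (Set.prod_mono (Set.subset_univ _) subset_rfl))
  -- The functional calculus commutes with the integral over the circle; Cauchy's formula then
  -- evaluates the scalar integral at each spectral point.
  have key : cfc (fun w => ∫ t in Set.Ioc (0 : ℝ) 1, F t w) x =
      ∫ t in Set.Ioc (0 : ℝ) 1, cfc (F t) x := by
    refine cfc_setIntegral measurableSet_Ioc F (fun _ => M) x
      (hF.mono (Set.prod_mono (Set.subset_univ _) subset_rfl)) ?_ ?_
    · filter_upwards [ae_restrict_mem measurableSet_Ioc] with t ht w hw
      exact hM (t, w) ⟨Set.Ioc_subset_Icc_self ht, hw⟩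
    · exact (integrable_const M).hasFiniteIntegral
  have hpt : ∀ w ∈ spectrum ℂ x, (∫ t in Set.Ioc (0 : ℝ) 1, F t w) = (2 * π * I) * f w := by
    intro w hw
    have h := (hf.mono hU).circleIntegral_sub_inv_smul (hx hw)
    rw [← intervalIntegral.integral_of_le zero_le_one]
    simp only [smul_eq_mul] at h
    rw [← h, ← integral_deriv_unitCircleMap_mul]
    simp only [F]
    congr 1; ext t; ring
  have hfx : ContinuousOn f (spectrum ℂ x) :=
    hf.continuousOn.mono ((hx.trans Metric.ball_subset_closedBall).trans hU)
  simp only [cauchyIntegralAlong, Finset.univ_unique, Finset.sum_singleton]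
  rw [intervalIntegral.integral_of_le zero_le_one]
  simp only [smul_resolvent_eq_cfc x _ (hnot _)]
  rw [← key, cfc_congr hpt, cfc_const_mul _ f x hfx, smul_smul,
    inv_mul_cancel₀ two_pi_I_ne_zero, one_smul]

/-! ### Passage to `1 × 1` matrices -/

/-- An algebra isomorphism preserves spectra and resolvents, and an isometric one commutes with the
integral. This carries the calculus from the completion to its 1 × 1 matrices, where locality is
stated. -/
lemma IsHolomorphicFunctionalCalculus.map {B C : Type*} [NormedRing B] [NormedAlgebra ℂ B]
    [CompleteSpace B] [NormedRing C] [NormedAlgebra ℂ C] (φ : B ≃ₐ[ℂ] C)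
    (hφ : Isometry φ) {x : B} {f : ℂ → ℂ} {y : B} (h : IsHolomorphicFunctionalCalculus x f y) :
    IsHolomorphicFunctionalCalculus (φ x) f (φ y) := by
  obtain ⟨U, hU, hxU, hf, N, γ, hγ, rfl⟩ := h
  have hs : spectrum ℂ (φ x) = spectrum ℂ x := AlgEquiv.spectrum_eq φ x
  refine ⟨U, hU, hs ▸ hxU, hf, N, γ, hs ▸ hγ, ?_⟩
  have : CompleteSpace C :=
    (completeSpace_congr (e := φ.toEquiv) hφ.isUniformEmbedding).1 inferInstance
  let ψ : B →ₗᵢ[ℂ] C := ⟨φ.toLinearMap, fun b => hφ.norm_map_of_map_zero (map_zero φ) b⟩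
  have hψ : ∀ b, ψ b = φ b := fun _ => rfl
  have hres : ∀ z : ℂ, φ (resolvent x z) = resolvent (φ x) z := fun z => by
    have hz : algebraMap ℂ C z - φ x = φ (algebraMap ℂ B z - x) := by
      rw [map_sub, AlgEquiv.commutes]
    simp only [resolvent, hz]
    by_cases h : IsUnit (algebraMap ℂ B z - x)
    · obtain ⟨u, hu⟩ := h
      rw [← hu, Ring.inverse_unit]
      exact (Ring.inverse_unit (Units.map (φ : B →* C) u)).symm
    -- On the spectrum both resolvents take the default value 0.
    · rw [Ring.inverse_non_unit _ h, map_zero,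
        Ring.inverse_non_unit _ fun h' => h ((MulEquiv.isUnit_map φ).1 h')]
  simp only [cauchyIntegralAlong, map_smul, map_sum]
  congr 1
  refine Finset.sum_congr rfl fun i _ => ?_
  rw [intervalIntegral.integral_of_le zero_le_one, intervalIntegral.integral_of_le zero_le_one,
    ← hψ, ← ψ.integral_comp_comm]
  simp only [hψ, map_smul, hres]

section

attribute [local instance] Matrix.linftyOpNormedRing Matrix.linftyOpNormedAlgebra

/-- A ring is isomorphic to its algebra of `1 × 1` matrices. -/
def matrixFinOneAlgEquiv (B : Type*) [NormedRing B] [NormedAlgebra ℂ B] :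
    B ≃ₐ[ℂ] Matrix (Fin 1) (Fin 1) B :=
  AlgEquiv.ofAlgHom (Matrix.scalarAlgHom (Fin 1) ℂ)
    { toFun := fun M => M 0 0
      map_one' := rfl
      map_mul' := fun M N => by simp [Matrix.mul_apply]
      map_zero' := rfl
      map_add' := fun _ _ => rfl
      commutes' := fun _ => by simp [Matrix.algebraMap_matrix_apply] }
    (by ext M i j; fin_cases i; fin_cases j; rfl)
    (by ext b; rfl)

lemma IsLocalBanachAlgebra.exists_coe_eq {A : Type*} [NormedRing A] [NormedAlgebra ℂ A]
    (hA : IsLocalBanachAlgebra A) (x : A) {f : ℂ → ℂ} {y : Completion A}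
    (h : IsHolomorphicFunctionalCalculus (x : Completion A) f y) : ∃ a : A, (a : Completion A) = y := by
  have hiso : Isometry (matrixFinOneAlgEquiv (Completion A)) := by
    refine AddMonoidHomClass.isometry_of_norm _ fun b => ?_
    simp [matrixFinOneAlgEquiv, Matrix.linfty_opNorm_def]
  have hx : matrixFinOneAlgEquiv (Completion A) (x : Completion A) =
      matrixToCompletion A 1 (fun _ _ => x) := by
    ext i j; fin_cases i; fin_cases j; rfl
  have hm := h.map _ hiso
  rw [hx] at hm
  obtain ⟨m, hm⟩ := hA 1 _ ⟨_, rfl⟩ f _ hm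
  exact ⟨m 0 0, congrFun (congrFun hm 0) 0⟩

end

/-! ### The completion of a local C*-algebra -/

lemma IsLocalCStarAlgebra.cstarRing {A : Type*} [NormedRing A] [NormedAlgebra ℂ A] [StarRing A]
    [StarModule ℂ A] (hA : IsLocalCStarAlgebra A) : CStarRing A :=
  ⟨fun x => by rw [hA.norm_star_mul_self x, sq]⟩

section

variable {A : Type*} [NormedRing A] [StarRing A]

/-- The extension is continuous by construction; that it restricts to the involution of A needs the
latter to be isometric, which follows from the C*-identity. -/
instance completionStar : Star (Completion A) := ⟨Completion.map star⟩

lemma continuous_completion_star : Continuous (star : Completion A → Completion A) :=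
  Completion.continuous_map

variable [CStarRing A]

lemma completion_coe_star (a : A) : ((star a : A) : Completion A) = star (a : Completion A) :=
  (Completion.map_coe star_isometry.uniformContinuous a).symm

instance completionStarRing : StarRing (Completion A) where
  star_involutive x := by
    induction x using Completion.induction_on with
    | hp =>
      exact isClosed_eq (continuous_completion_star.comp continuous_completion_star)
        continuous_id
    | ih a =>
      rw [← completion_coe_star, ← completion_coe_star, star_star]
  star_mul x y := by
    induction x, y using Completion.induction_on₂ with
    | hp =>
      exact isClosed_eq (continuous_completion_star.comp continuous_mul)
        ((continuous_completion_star.comp continuous_snd).mul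
          (continuous_completion_star.comp continuous_fst))
    | ih a b =>
      rw [← Completion.coe_mul, ← completion_coe_star, star_mul, Completion.coe_mul,
        completion_coe_star, completion_coe_star]
  star_add x y := by
    induction x, y using Completion.induction_on₂ with
    | hp =>
      exact isClosed_eq (continuous_completion_star.comp continuous_add)
        ((continuous_completion_star.comp continuous_fst).add
          (continuous_completion_star.comp continuous_snd))
    | ih a b =>
      rw [← Completion.coe_add, ← completion_coe_star, star_add, Completion.coe_add,
        completion_coe_star, completion_coe_star]

/-- The completion of a normed `*`-algebra with the C*-identity is a C*-algebra. -/
instance completionCStarAlgebra [NormedAlgebra ℂ A] [StarModule ℂ A] :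
    CStarAlgebra (Completion A) where
  norm_mul_self_le x := by
    induction x using Completion.induction_on with
    | hp =>
      exact isClosed_le (continuous_norm.mul continuous_norm)
        ((continuous_completion_star.mul continuous_id).norm)
    | ih a =>
      rw [← completion_coe_star, ← Completion.coe_mul, Completion.norm_coe,
        Completion.norm_coe, CStarRing.norm_star_mul_self]
  star_smul r x := by
    induction x using Completion.induction_on with
    | hp =>
      exact isClosed_eq (continuous_completion_star.comp (continuous_const_smul r))
        (continuous_completion_star.const_smul (star r))
    | ih a =>
      rw [← Completion.coe_smul, ← completion_coe_star, star_smul, Completion.coe_smul,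
        completion_coe_star]
  norm_smul_le := norm_smul_le

end

/-! ### Square roots of strictly positive elements -/

/-- A strictly positive element of a C*-algebra has an invertible self-adjoint square root which,
like its inverse, is given by the holomorphic functional calculus. -/
lemma exists_holomorphic_sqrt {B : Type*} [CStarAlgebra B] [PartialOrder B] [StarOrderedRing B]
    {x : B} {ε : ℝ} (hε : 0 < ε) (hx : algebraMap ℝ B ε ≤ x) :
    ∃ (y w : B) (f g : ℂ → ℂ), IsHolomorphicFunctionalCalculus x f y ∧
      IsHolomorphicFunctionalCalculus x g w ∧ IsSelfAdjoint y ∧ y * y = x ∧ y * w = 1 ∧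
      w * y = 1 := by
  have hsa : IsSelfAdjoint x :=
    .of_nonneg ((algebraMap_nonneg B hε.le).trans hx)
  have hnormal : IsStarNormal x := hsa.isStarNormal
  -- The factor ‖1‖ is kept because the zero algebra is not excluded.
  set M : ℝ := ‖x‖ * ‖(1 : B)‖
  have hspec : ∀ w ∈ spectrum ℂ x, ∃ r : ℝ, w = r ∧ ε ≤ r ∧ r ≤ M := by
    intro w hw
    have hre : w = (w.re : ℂ) := hsa.mem_spectrum_eq_re hw
    have hwR : w.re ∈ spectrum ℝ x := by
      rw [← spectrum.preimage_algebraMap ℂ]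
      simpa [← hre] using hw
    refine ⟨w.re, hre, (algebraMap_le_iff_le_spectrum (a := x) hsa).1 hx _ hwR, ?_⟩
    have h := spectrum.subset_closedBall_norm_mul (𝕜 := ℂ) x hw
    exact (Complex.re_le_norm w).trans (by simpa [M] using h)
  have hM : 0 ≤ M := by positivity
  -- The disc meets the real axis in the interval from ε/2 to 2M + 3ε/2: it contains [ε, M] and
  -- stays in the right half-plane.
  set c : ℂ := ((M + ε : ℝ) : ℂ)
  set R : ℝ := M + ε / 2
  have hR : 0 < R := by positivity
  have hball : spectrum ℂ x ⊆ Metric.ball c R := by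
    intro w hw
    obtain ⟨r, rfl, h1, h2⟩ := hspec w hw
    rw [Metric.mem_ball, Complex.dist_eq, ← Complex.ofReal_sub, Complex.norm_real,
      Real.norm_eq_abs, abs_lt]
    constructor <;> simp only [R] <;> linarith
  have hU : Metric.closedBall c R ⊆ slitPlane := by
    intro w hw
    rw [Metric.mem_closedBall, Complex.dist_eq, norm_sub_rev] at hw
    have h := (Complex.re_le_norm (c - w)).trans hw
    have hc : c.re = M + ε := Complex.ofReal_re _
    rw [Complex.sub_re, hc] at h
    refine Or.inl ?_
    simp only [R] at h
    linarith
  obtain ⟨f, hf_def⟩ : ∃ f : ℂ → ℂ, f = fun w => w ^ (1 / 2 : ℂ) := ⟨_, rfl⟩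
  have hfw : ∀ w, f w = w ^ (1 / 2 : ℂ) := fun w => congrFun hf_def w
  have hne : ∀ w ∈ slitPlane, f w ≠ 0 := fun w hw h =>
    slitPlane_ne_zero hw ((cpow_eq_zero_iff _ _).1 (hfw w ▸ h)).1
  have hf : DifferentiableOn ℂ f slitPlane := hf_def ▸ fun w hw =>
    (differentiableAt_id.cpow (differentiableAt_const _) hw).differentiableWithinAt
  have hg : DifferentiableOn ℂ (fun w => (f w)⁻¹) slitPlane := hf.inv hne
  have hsub : spectrum ℂ x ⊆ slitPlane := (hball.trans Metric.ball_subset_closedBall).trans hU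
  have hfc : ContinuousOn f (spectrum ℂ x) := hf.continuousOn.mono hsub
  have hgc : ContinuousOn (fun w => (f w)⁻¹) (spectrum ℂ x) := hg.continuousOn.mono hsub
  refine ⟨cfc f x, cfc (fun w => (f w)⁻¹) x, _, _,
    isHolomorphicFunctionalCalculus_cfc x hR isOpen_slitPlane hball hU hf,
    isHolomorphicFunctionalCalculus_cfc x hR isOpen_slitPlane hball hU hg, ?_, ?_, ?_, ?_⟩
  · rw [IsSelfAdjoint, ← cfc_star]
    refine cfc_congr fun w hw => ?_
    obtain ⟨r, rfl, h1, -⟩ := hspec w hw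
    -- The principal root is real on the spectrum, hence the self-adjointness.
    have : f r = ((r ^ (1 / 2 : ℝ) : ℝ) : ℂ) := by
      rw [Complex.ofReal_cpow (hε.le.trans h1)]
      simp [hfw]
    simp only [this]
    exact Complex.conj_ofReal _
  · rw [← cfc_mul f f x hfc hfc]
    refine (cfc_congr fun w hw => ?_).trans (cfc_id' ℂ x)
    rw [hfw, ← Complex.cpow_add _ _ (slitPlane_ne_zero (hsub hw))]
    norm_num
  · rw [← cfc_mul f _ x hfc hgc]
    exact (cfc_congr fun w hw => mul_inv_cancel₀ (hne w (hsub hw))).trans (cfc_const_one ℂ x)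
  · rw [← cfc_mul _ f x hgc hfc]
    exact (cfc_congr fun w hw => inv_mul_cancel₀ (hne w (hsub hw))).trans (cfc_const_one ℂ x)

/-- Induction on (x + y)^*(x + y) ≤ 2 x^*x + 2 y^*y, where the difference of the two sides is (x -
y)^*(x - y). The constant is crude; only its finiteness matters. -/
lemma star_sum_mul_sum_le {B ι : Type*} [CStarAlgebra B] [PartialOrder B] [StarOrderedRing B]
    (s : Finset ι) (a : ι → B) :
    star (∑ i ∈ s, a i) * ∑ i ∈ s, a i ≤ (2 ^ s.card : ℝ) • ∑ i ∈ s, star (a i) * a i := by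
  classical
  induction s using Finset.induction_on with
  | empty => simp
  | insert i s hi ih =>
    rw [Finset.sum_insert hi, Finset.sum_insert hi, Finset.card_insert_of_notMem hi, pow_succ']
    set b := ∑ j ∈ s, a j
    set T := ∑ j ∈ s, star (a j) * a j
    have h1 : star (a i + b) * (a i + b) ≤ (2 : ℝ) • (star (a i) * a i) + (2 : ℝ) • (star b * b) := by
      rw [← sub_nonneg]
      convert star_mul_self_nonneg (a i - b) using 1
      simp only [star_add, star_sub, two_smul]
      noncomm_ring
    have h2 : (2 : ℝ) • (star b * b) ≤ (2 : ℝ) • ((2 ^ s.card : ℝ) • T) :=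
      smul_le_smul_of_nonneg_left ih zero_le_two
    have h3 : (2 : ℝ) • (star (a i) * a i) ≤ (2 * 2 ^ s.card : ℝ) • (star (a i) * a i) :=
      smul_le_smul_of_nonneg_right (by linarith [one_le_pow₀ (n := s.card) one_le_two (M₀ := ℝ)])
        (star_mul_self_nonneg _)
    rw [smul_add]
    exact h1.trans (add_le_add h3 (h2.trans_eq (smul_smul _ _ _)))

/-- In a local C*-algebra, if some of the `a i` add up to `1` then `∑ i, star (a i) * a i` has an
invertible self-adjoint square root. -/
lemma IsLocalCStarAlgebra.exists_sqrt_sum_star_mul_self {A : Type*} [NormedRing A]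
    [NormedAlgebra ℂ A] [StarRing A] [StarModule ℂ A] (hA : IsLocalCStarAlgebra A) {ι : Type*}
    {s t : Finset ι} (hst : s ⊆ t) (a : ι → A) (ha : ∑ i ∈ s, a i = 1) :
    ∃ z : Aˣ, IsSelfAdjoint (z : A) ∧ (z * z : A) = ∑ i ∈ t, star (a i) * a i := by
  have := hA.cstarRing
  let _ := CStarAlgebra.spectralOrder (Completion A)
  let _ := CStarAlgebra.spectralOrderedRing (Completion A)
  set S : A := ∑ i ∈ t, star (a i) * a i
  let b : ι → Completion A := fun i => (a i : Completion A)
  have hb : ∑ i ∈ s, b i = 1 := by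
    have h := congrArg (Completion.coeRingHom (α := A)) ha
    rwa [map_sum, map_one] at h
  have hS : (S : Completion A) = ∑ i ∈ t, star (b i) * b i := by
    have h : Completion.coeRingHom S = ∑ i ∈ t, Completion.coeRingHom (star (a i) * a i) :=
      map_sum _ _ _
    refine h.trans (Finset.sum_congr rfl fun i _ => ?_)
    rw [map_mul]
    exact congrArg (· * b i) (completion_coe_star (a i))
  -- Here 1 is (∑ a_i)^* (∑ a_i) over `s`; the terms of `t` outside `s` only increase the right-hand
  -- side.
  have h1 : (1 : Completion A) ≤ (2 ^ s.card : ℝ) • (S : Completion A) := by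
    have h := star_sum_mul_sum_le s b
    rw [hb, star_one, one_mul] at h
    refine h.trans (smul_le_smul_of_nonneg_left ?_ (by positivity))
    rw [hS]
    exact Finset.sum_le_sum_of_subset_of_nonneg hst fun i _ _ => star_mul_self_nonneg _
  have h2 : algebraMap ℝ (Completion A) ((2 ^ s.card : ℝ)⁻¹) ≤ (S : Completion A) := by
    have h := smul_le_smul_of_nonneg_left h1 (inv_nonneg.2 (by positivity : (0 : ℝ) ≤ 2 ^ s.card))
    rwa [smul_smul, inv_mul_cancel₀ (by positivity), one_smul, ← Algebra.algebraMap_eq_smul_one]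
      at h
  obtain ⟨y, w, f, g, hy, hw, hsa, hyy, hyw, hwy⟩ := exists_holomorphic_sqrt (by positivity) h2
  -- Both the root and its inverse descend to A, so the root is a unit of A and not merely of the
  -- completion.
  obtain ⟨y, rfl⟩ := hA.isLocalBanachAlgebra.exists_coe_eq S hy
  obtain ⟨w, rfl⟩ := hA.isLocalBanachAlgebra.exists_coe_eq S hw
  have hinj : Function.Injective ((↑) : A → Completion A) := Completion.coe_injective A
  refine ⟨⟨y, w, hinj ?_, hinj ?_⟩, hinj ?_, hinj ?_⟩
  · rw [Completion.coe_mul, hyw, Completion.coe_one]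
  · rw [Completion.coe_mul, hwy, Completion.coe_one]
  · rw [completion_coe_star]; exact hsa
  · rw [Completion.coe_mul, hyy]

/-! ### Similarity -/

/-- The hypothesis says that b is the adjoint of a for the form given by z²; conjugation by z turns
this form into the standard one. -/
lemma star_conj_eq_conj {A : Type*} [Ring A] [StarRing A] {z : Aˣ} (hz : IsSelfAdjoint (z : A))
    {a b : A} (h : star a * (z * z) = z * z * b) : star (z * a * ↑z⁻¹ : A) = z * b * ↑z⁻¹ := by
  have hz' : star (↑z⁻¹ : A) = ↑z⁻¹ := by
    rw [← Units.coe_star_inv, show star z = z from Units.ext hz]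
  rw [star_mul, star_mul, hz', hz.star_eq]
  calc (↑z⁻¹ : A) * (star a * z) = ↑z⁻¹ * (star a * (z * z)) * ↑z⁻¹ := by
        simp only [mul_assoc, Units.mul_inv, mul_one]
    _ = z * b * ↑z⁻¹ := by rw [h]; simp only [mul_assoc, Units.inv_mul_cancel_left]

lemma conj_pow_eq {A : Type*} [Ring A] (z : Aˣ) (a : A) (m : ℕ) :
    (z * a * ↑z⁻¹ : A) ^ m = z * a ^ m * ↑z⁻¹ :=
  Units.conj_pow z a m

/-- Every partition of unity in a local C*-algebra is similar to a self-adjoint one. -/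
theorem IsPartitionOfUnity.exists_isSimilarPartition {A : Type*} [NormedRing A] [NormedAlgebra ℂ A]
    [StarRing A] [StarModule ℂ A] (hA : IsLocalCStarAlgebra A) {n : ℕ} {e : Fin n → A}
    (he : IsPartitionOfUnity e) :
    ∃ p : Fin n → A, IsSelfAdjointPartition p ∧ IsSimilarPartition e p := by
  obtain ⟨z, hz, hS⟩ := hA.exists_sqrt_sum_star_mul_self
    (Finset.Subset.refl Finset.univ) e he.complete
  have hl : ∀ k, (z * z : A) * e k = star (e k) * e k := fun k => by
    rw [hS, Finset.sum_mul, Finset.sum_eq_single k _ (by simp)]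
    · rw [mul_assoc, (he.idem k).eq]
    · intro j _ hj
      rw [mul_assoc, he.ortho hj, mul_zero]
  have hr : ∀ k, star (e k) * (z * z : A) = star (e k) * e k := fun k => by
    have h := congrArg star (hl k)
    rwa [star_mul, star_mul, star_mul, hz.star_eq, star_star] at h
  refine ⟨fun k => z * e k * ↑z⁻¹, ⟨?_, fun k => ?_⟩, z, fun k => rfl⟩
  · refine ⟨⟨fun k => ?_, fun j k hjk => ?_⟩, ?_⟩
    · have h := conj_pow_eq z (e k) 2
      rwa [pow_two, pow_two, (he.idem k).eq] at h
    · simp only [mul_assoc, Units.inv_mul_cancel_left]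
      rw [← mul_assoc (e j), he.ortho hjk, zero_mul, mul_zero]
    · rw [← Finset.sum_mul, ← Finset.mul_sum, he.complete, mul_one, Units.mul_inv]
  · exact star_conj_eq_conj hz ((hr k).trans (hl k).symm)

/-- Every `n`-potent, `n ≥ 2`, in a local C*-algebra is similar to a normal one. -/
theorem IsNPotent.exists_isStarNormal_isSimilar {A : Type*} [NormedRing A] [NormedAlgebra ℂ A]
    [StarRing A] [StarModule ℂ A] (hA : IsLocalCStarAlgebra A) {n : ℕ} (hn : 2 ≤ n) {e : A}
    (he : IsNPotent n e) : ∃ f : A, IsNPotent n f ∧ IsStarNormal f ∧ IsSimilar e f := by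
  obtain ⟨k, rfl⟩ := Nat.exists_eq_add_of_le' hn
  have he' : e ^ (k + 2) = e := he
  -- Periodicity starts at exponent 1, since e^{k+1} need not be 1.
  have hper : ∀ m, e ^ (m + 1 + (k + 1)) = e ^ (m + 1) := fun m => by
    rw [show m + 1 + (k + 1) = m + (k + 2) by ring, pow_add, he', pow_succ]
  -- Index 0 carries the complementary idempotent in place of e^0 = 1, so that terms 0 and k + 1 add
  -- up to 1 and e annihilates term 0.
  let a : ℕ → A := fun j => if j = 0 then 1 - e ^ (k + 1) else e ^ j
  obtain ⟨z, hz, hS⟩ := hA.exists_sqrt_sum_star_mul_self (s := {0, k + 1})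
    (t := Finset.range (k + 2)) (by intro j; simp; omega) a (by simp [a])
  have h0 : (1 - e ^ (k + 1)) * e = 0 := by
    rw [sub_mul, one_mul, ← pow_succ, he', sub_self]
  have h0' : star e * star (1 - e ^ (k + 1)) = 0 := by rw [← star_mul, h0, star_zero]
  -- The element e^{2k+1} inverts e relative to the idempotent e^{k+1}. The exponent k = n - 2 would
  -- fail for n = 2, where e^0 = 1.
  have hSe : star e * (z * z : A) = z * z * e ^ (2 * k + 1) := by
    rw [hS, Finset.sum_range_succ']
    simp only [a, Nat.add_one_ne_zero, if_false, if_true]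
    rw [mul_add, add_mul, ← mul_assoc, h0', zero_mul, add_zero, mul_assoc (star (1 - e ^ (k + 1))),
      pow_succ' e (2 * k), ← mul_assoc (1 - e ^ (k + 1)), h0, zero_mul, mul_zero, add_zero,
      ← pow_succ', Finset.mul_sum, Finset.sum_mul, Finset.sum_range_succ, Finset.sum_range_succ']
    -- Multiplication by e^* shifts the sum cyclically: the last term on the left, with e^{k+2} = e,
    -- matches the first on the right.
    congr 1
    · refine Finset.sum_congr rfl fun j _ => ?_
      rw [← mul_assoc, ← star_mul, ← pow_succ, mul_assoc, ← pow_add,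
        show j + 1 + 1 + (2 * k + 1) = j + (k + 1) + 1 + (k + 1) by ring, hper,
        show j + (k + 1) + 1 = j + 1 + (k + 1) by ring, hper]
    · rw [← mul_assoc, ← star_mul, ← pow_succ, he', mul_assoc, ← pow_add,
        show 0 + 1 + (2 * k + 1) = k + 1 + (k + 1) by ring, hper, zero_add, pow_one]
  refine ⟨z * e * ↑z⁻¹, ?_, ⟨?_⟩, z, rfl⟩
  · rw [IsNPotent, conj_pow_eq, he']
  -- The adjoint of f = z e z⁻¹ is f^{2k+1}, which commutes with f.
  · rw [star_conj_eq_conj hz hSe, ← conj_pow_eq]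
    exact (Commute.refl _).pow_left _

theorem mainTheorem8 {A : Type*} [NormedRing A] [NormedAlgebra ℂ A] [StarRing A] [StarModule ℂ A]
    (hA : IsLocalCStarAlgebra A) (n : ℕ) (hn : 2 ≤ n) :
    (∀ e : Fin n → A, IsPartitionOfUnity e →
      ∃ p : Fin n → A, IsSelfAdjointPartition p ∧ IsSimilarPartition e p) ∧
    (∀ e : A, IsNPotent n e →
      ∃ f : A, IsNPotent n f ∧ IsStarNormal f ∧ IsSimilar e f) :=
  ⟨fun _ he => he.exists_isSimilarPartition hA, fun _ he => he.exists_isStarNormal_isSimilar hA hn⟩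

end
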